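/- Let $\mathbb I=[0,1]$ with Lebesgue measure $\lambda$. Identify a three-dimensional copula $C$ with its 3-stochastic measure $\mu_C$ on $\mathbb I^2\times\mathbb I$ (all three one-dimensional marginals equal $\lambda$), so that $C(u_1,u_2,v)=\mu_C([0,u_1]\times[0,u_2]\times[0,v])$, and likewise a bivariate copula $A$ with a doubly stochastic measure on $\mathbb I^2$. Let $K_C(t,\cdot)$ be the regular conditional distribution under $\mu_C$ of the first two coordinates given that the third one equals $t$, and put $F_{1|3}(u|t)=K_C(t,[0,u]\times\mathbb I)$, $F_{2|3}(u|t)=K_C(t,\mathbb I\times[0,u])$. Call $C$ *simplified* if $F_{1|3}(\cdot|t)$ and $F_{2|3}(\cdot|t)$ are continuous for $\lambda$-almost every $t$ and there is a bivariate copula $A$ (not depending on $t$) with $$C(u_1,u_2,v)=\int_{[0,v]}A\big(F_{1|3}(u_1|t),F_{2|3}(u_2|t)\big)\,d\lambda(t)\qquad\text{for all }u_1,u_2,v\in\mathbb I.$$ Let $\mathcal C^3_{\mathrm{ac},>0}$ be the class of all three-dimensional copulas that are absolutely continuous with a density that is positive $\lambda^3$-almost everywhere, let $\mathcal S\subseteq\mathcal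 C^3_{\mathrm{ac},>0}$ be the set of the simplified ones, and let $\mathrm{KL}(C,D)=\int\log\frac{d\mu_C}{d\mu_D}\,d\mu_C\in[0,\infty]$ be the Kullback–Leibler divergence. **Theorem.** $\mathcal S$ is nowhere dense in $(\mathcal C^3_{\mathrm{ac},>0},\mathrm{KL})$. Precisely, let $\delta(D,C)=\mathrm{KL}(D,C)$ or $\delta(D,C)=\mathrm{KL}(C,D)$, and for $C\in\mathcal C^3_{\mathrm{ac},>0}$ and $r\in(0,\infty]$ let $B_\delta(C,r)=\{D\in\mathcal C^3_{\mathrm{ac},>0}:\delta(D,C)<r\}$. Then, for each of the two choices of $\delta$: 1. in the topology on $\mathcal C^3_{\mathrm{ac},>0}$ whose open sets are the sets $U$ such that every $C\in U$ has some $r>0$ with $B_\delta(C,r)\subseteq U$, the closure of $\mathcal S$ has empty interior; 2. no ball $B_\delta(C,r)$ with $C\in\mathcal C^3_{\mathrm{ac},>0}$ and $r>0$ is contained in the set of all $D\in\mathcal C^3_{\mathrm{ac},>0}$ such that for every $\varepsilon>0$ there is $S\in\mathcal S$ with $\delta(S,D)<\varepsilon$. -/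

import Mathlib

open MeasureTheory ProbabilityTheory Set Filter Topology InformationTheory
open scoped ENNReal unitInterval

noncomputable section

/-- A bivariate copula, given by its doubly stochastic measure `μ_A` on `[0,1]²`: a
Borel measure both of whose one-dimensional marginals are Lebesgue measure on `[0,1]`. -/
@[ext]
structure BivariateCopula where
  measure : Measure (I × I)
  map_fst : measure.map Prod.fst = volume
  map_snd : measure.map Prod.snd = volume

namespace BivariateCopula

/-- The copula itself, as the function `A(u₁, u₂) = μ_A([0,u₁] × [0,u₂])` on `[0,1]²`. -/
def cdf (A : BivariateCopula) (u₁ u₂ : I) : ℝ := A.measure.real (Iic u₁ ×ˢ Iic u₂)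

end BivariateCopula

/-- A three-dimensional copula, given by its 3-stochastic measure `μ_C` on `[0,1]² × [0,1]`: a
Borel measure whose three one-dimensional marginals are Lebesgue measure on `[0,1]`.
Points are written `((u₁, u₂), v)`. -/
@[ext]
structure TrivariateCopula where
  measure : Measure ((I × I) × I)
  map_one : measure.map (fun x => x.1.1) = volume
  map_two : measure.map (fun x => x.1.2) = volume
  map_three : measure.map (fun x => x.2) = volume

namespace TrivariateCopula

instance (C : TrivariateCopula) : IsProbabilityMeasure C.measure := by
  constructor
  have h : (C.measure.map (fun x => x.2)) univ = 1 := by rw [C.map_three]; exact measure_univ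
  rwa [Measure.map_apply measurable_snd MeasurableSet.univ, preimage_univ] at h

/-- The copula itself, as the function `C(u₁, u₂, v) = μ_C([0,u₁] × [0,u₂] × [0,v])`. -/
def cdf (C : TrivariateCopula) (u₁ u₂ v : I) : ℝ :=
  C.measure.real ((Iic u₁ ×ˢ Iic u₂) ×ˢ Iic v)

/-- The Markov kernel of `C`: the regular conditional distribution of the first
two coordinates given the third one. -/
def kernel (C : TrivariateCopula) : Kernel I (I × I) :=
  condDistrib Prod.fst Prod.snd C.measure

instance (C : TrivariateCopula) : IsMarkovKernel C.kernel := by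
  unfold kernel; infer_instance

/-- The conditional univariate distribution function `F_{1|3}(u | t)`. -/
def F₁ (C : TrivariateCopula) (t u : I) : I :=
  ⟨(C.kernel t).real (Iic u ×ˢ univ), measureReal_nonneg, measureReal_le_one⟩

/-- The conditional univariate distribution function `F_{2|3}(u | t)`. -/
def F₂ (C : TrivariateCopula) (t u : I) : I :=
  ⟨(C.kernel t).real (univ ×ˢ Iic u), measureReal_nonneg, measureReal_le_one⟩

/-- `C` is generalized simplified (with respect to the third coordinate): one bivariate copula
`A`, not depending on `t`, serves as conditional copula of the first two coordinates given the
third coordinate `t`. -/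
def IsGeneralizedSimplified (C : TrivariateCopula) : Prop :=
  ∃ A : BivariateCopula, ∀ u₁ u₂ v : I,
    C.cdf u₁ u₂ v = ∫ t in Iic v, A.cdf (C.F₁ t u₁) (C.F₂ t u₂)

/-- Almost all conditional univariate distribution functions of `C` are continuous. -/
def HasContinuousConditionals (C : TrivariateCopula) : Prop :=
  ∀ᵐ t : I, Continuous (C.F₁ t) ∧ Continuous (C.F₂ t)

/-- `C` is simplified. -/
def IsSimplified (C : TrivariateCopula) : Prop :=
  C.IsGeneralizedSimplified ∧ C.HasContinuousConditionals

/-- `C` is absolutely continuous with a density that is positive Lebesgue-almost everywhere. -/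
def HasPositiveDensity (C : TrivariateCopula) : Prop :=
  C.measure ≪ volume ∧ ∀ᵐ x, 0 < C.measure.rnDeriv volume x

end TrivariateCopula

/-- The class of all absolutely continuous three-dimensional copulas with positive density. -/
abbrev PositiveCopula : Type := {C : TrivariateCopula // C.HasPositiveDensity}

/-- The collection of all simplified copulas with positive density. -/
def simplifiedCopulas : Set PositiveCopula := {C | C.1.IsSimplified}

/-- The Kullback-Leibler divergence `KL(C, D) = ∫ log (c / d) dμ_C`, in `[0, ∞]`. -/
def KL (C D : PositiveCopula) : ℝ≥0∞ := klDiv C.1.measure D.1.measure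

/-- The ball of radius `r` around `x` with respect to a divergence `δ`, which need neither be
symmetric nor satisfy a triangle inequality; the moving point is the first argument of `δ`. -/
def divBall {X : Type*} (δ : X → X → ℝ≥0∞) (x : X) (r : ℝ≥0∞) : Set X := {y | δ y x < r}

/-- The set of points that can be approximated arbitrarily well by points of `S`. -/
def divClosure {X : Type*} (δ : X → X → ℝ≥0∞) (S : Set X) : Set X :=
  {x | ∀ ε : ℝ≥0∞, 0 < ε → (divBall δ x ε ∩ S).Nonempty}

/-- The topology induced by a divergence `δ`: a set is open if with every
point it contains a ball around this point. -/
@[reducible]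
def divTopology {X : Type*} (δ : X → X → ℝ≥0∞) : TopologicalSpace X where
  IsOpen U := ∀ x ∈ U, ∃ r : ℝ≥0∞, 0 < r ∧ divBall δ x r ⊆ U
  isOpen_univ := fun _ _ => ⟨1, one_pos, subset_univ _⟩
  isOpen_inter := by
    rintro U V hU hV x ⟨hxU, hxV⟩
    obtain ⟨r, hr, hrU⟩ := hU x hxU
    obtain ⟨s, hs, hsV⟩ := hV x hxV
    exact ⟨min r s, lt_min hr hs, fun y hy =>
      ⟨hrU (lt_of_lt_of_le hy (min_le_left r s)), hsV (lt_of_lt_of_le hy (min_le_right r s))⟩⟩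
  isOpen_sUnion := by
    rintro 𝒰 h x ⟨U, hU, hx⟩
    obtain ⟨r, hr, hrU⟩ := h U hU x hx
    exact ⟨r, hr, hrU.trans (subset_sUnion_of_mem hU)⟩

/-- `S` is nowhere dense with respect to `δ`: its closure in the induced topology has empty
interior, and, moreover, the set of points that can be approximated arbitrarily well by points
of `S` contains no ball. For a metric `δ` both mean the usual notion; for a general
divergence, balls need not be open and the set of approximable points need not be closed. -/
def NowhereDenseWrt {X : Type*} (δ : X → X → ℝ≥0∞) (S : Set X) : Prop :=
  @IsNowhereDense X (divTopology δ) S ∧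
    ∀ (x : X) (r : ℝ≥0∞), 0 < r → ¬ divBall δ x r ⊆ divClosure δ S

end

/-! In either order of its arguments, small divergence forces setwise closeness
(`setwiseClose_of_klDiv_le`). Both notions of closure of the simplified copulas are therefore
contained in their setwise closure, and it suffices that the setwise closure contains no ball.

Setwise limits of simplified copulas are rigid. For such a limit C there are bivariate copulas A_n
such that, for each (u₁, u₂), A_n(F_{1|3}(u₁|t), F_{2|3}(u₂|t)) tends in L¹(dt) to the conditional
distribution function of C at (u₁, u₂). Let D be another such limit, with copulas A'_n and the same
(1,3) and (2,3) margins as C, hence the same F_{1|3} and F_{2|3}. If C and D share their conditional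
laws on a set T of positive measure, then for some t in T the difference A_n - A'_n tends to 0 at
the points (F_{1|3}(u₁|t), F_{2|3}(u₂|t)) with u₁, u₂ in a countable dense set. These points are
dense in the square, because the conditional distribution functions are continuous and onto, and
copulas are uniformly Lipschitz. So A_n - A'_n tends to 0 everywhere, and C = D
(`measureReal_prod_eq_of_mem_setwiseClosure`). No limit of A_n itself is needed.

Yet every ball around C contains a D violating this (`exists_perturbed_copula`). For t < 1/2, a
little mass is moved from two opposite quadrants of the square to the other two, in a
reflection-invariant way that keeps both margins; for t ≥ 1/2 nothing changes. Hence C and D, both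
in the ball, cannot both be setwise limits. -/

/-! ### Kullback-Leibler divergence and setwise closeness -/

/-- Setwise closeness of two measures, uniformly over all measurable sets. -/
def SetwiseClose {α : Type*} [MeasurableSpace α] (η : ℝ) (μ ν : Measure α) : Prop :=
  ∀ E, MeasurableSet E → |μ.real E - ν.real E| ≤ η

theorem SetwiseClose.symm {α : Type*} [MeasurableSpace α] {η : ℝ} {μ ν : Measure α}
    (h : SetwiseClose η μ ν) : SetwiseClose η ν μ := fun E hE => by
  rw [abs_sub_comm]; exact h E hE

theorem SetwiseClose.trans {α : Type*} [MeasurableSpace α] {η θ : ℝ} {μ ν ρ : Measure α}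
    (h : SetwiseClose η μ ν) (h' : SetwiseClose θ ν ρ) : SetwiseClose (η + θ) μ ρ :=
  fun E hE => (abs_sub_le _ _ _).trans (add_le_add (h E hE) (h' E hE))

/-- The Fenchel-Young inequality for `klFun` and its conjugate `s ↦ exp s - 1`. -/
theorem mul_le_klFun_add_exp_sub_one {x : ℝ} (hx : 0 ≤ x) (s : ℝ) :
    x * s ≤ klFun x + (Real.exp s - 1) := by
  -- Nonnegativity of `klFun` at x·exp(-s), multiplied by exp(s), is the claim.
  have h := klFun_nonneg (x := x * Real.exp (-s)) (by positivity)
  rcases hx.eq_or_lt with rfl | hx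
  · simp [klFun, Real.exp_nonneg]
  rw [klFun_apply, Real.log_mul hx.ne' (Real.exp_ne_zero _), Real.log_exp] at h
  rw [klFun_apply]
  have h1 : Real.exp s * Real.exp (-s) = 1 := by rw [← Real.exp_add]; simp
  have h2 := mul_le_mul_of_nonneg_left h (Real.exp_nonneg s)
  have h3 : Real.exp s * (x * Real.exp (-s) * (Real.log x + -s) + 1 - x * Real.exp (-s))
      = (Real.exp s * Real.exp (-s)) * (x * (Real.log x - s) - x) + Real.exp s := by ring
  rw [h3, h1] at h2
  linarith

/-- A weak form of Pinsker's inequality for a single set. -/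
theorem measureReal_sub_le_of_klDiv_le {α : Type*} [MeasurableSpace α] {μ ν : Measure α}
    [IsProbabilityMeasure μ] [IsProbabilityMeasure ν] {s : ℝ} (hs : 0 < s) (hs1 : s ≤ 1)
    (h : klDiv μ ν ≤ ENNReal.ofReal (s ^ 2)) (E : Set α) :
    μ.real E - ν.real E ≤ 2 * s := by
  have htop : klDiv μ ν ≠ ∞ := (h.trans_lt ENNReal.ofReal_lt_top).ne
  obtain ⟨hac, hint⟩ := klDiv_ne_top_iff.1 htop
  have hkl : ∫ x, klFun (μ.rnDeriv ν x).toReal ∂ν ≤ s ^ 2 := by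
    rw [← toReal_klDiv_eq_integral_klFun hac]
    exact ENNReal.toReal_le_of_le_ofReal (by positivity) h
  have hki : Integrable (fun x => klFun (μ.rnDeriv ν x).toReal) ν :=
    (integrable_klFun_rnDeriv_iff hac).2 hint
  have hE' : ∫ x in E, klFun (μ.rnDeriv ν x).toReal ∂ν ≤ s ^ 2 :=
    (setIntegral_le_integral hki
      (Eventually.of_forall fun x => klFun_nonneg ENNReal.toReal_nonneg)).trans hkl
  -- Fenchel-Young integrated over E. Its slope s is the square root of the divergence bound, so the
  -- divergence and the second-order term of exp s - 1 each cost s², and dividing by s leaves 2s.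
  have h1 : μ.real E * s ≤ s ^ 2 + ν.real E * (Real.exp s - 1) := by
    calc μ.real E * s = ∫ x in E, (μ.rnDeriv ν x).toReal * s ∂ν := by
          rw [integral_mul_const, Measure.setIntegral_toReal_rnDeriv hac]
      _ ≤ ∫ x in E, (klFun (μ.rnDeriv ν x).toReal + (Real.exp s - 1)) ∂ν := by
          apply integral_mono
          · exact (Measure.integrable_toReal_rnDeriv.mul_const s).integrableOn
          · exact (hki.add (integrable_const _)).integrableOn
          · exact fun x => mul_le_klFun_add_exp_sub_one ENNReal.toReal_nonneg s
      _ = (∫ x in E, klFun (μ.rnDeriv ν x).toReal ∂ν) + ν.real E * (Real.exp s - 1) := by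
          rw [integral_add hki.integrableOn (integrable_const _), integral_const]
          simp
      _ ≤ _ := by gcongr
  have h2 : Real.exp s - 1 ≤ s + s ^ 2 := by
    have := Real.abs_exp_sub_one_sub_id_le (x := s) (by rw [abs_of_pos hs]; exact hs1)
    linarith [(abs_le.1 this).2]
  have h3 : ν.real E ≤ 1 := measureReal_le_one
  have h4 : ν.real E * (Real.exp s - 1) ≤ ν.real E * s + s ^ 2 := by
    calc ν.real E * (Real.exp s - 1) ≤ ν.real E * (s + s ^ 2) := by gcongr
      _ = ν.real E * s + ν.real E * s ^ 2 := by ring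
      _ ≤ ν.real E * s + 1 * s ^ 2 := by gcongr
      _ = _ := by ring
  have h5 : (μ.real E - ν.real E) * s ≤ (2 * s) * s := by nlinarith
  exact le_of_mul_le_mul_right h5 hs

/-- A weak form of Pinsker's inequality. -/
theorem setwiseClose_of_klDiv_le {α : Type*} [MeasurableSpace α] {μ ν : Measure α}
    [IsProbabilityMeasure μ] [IsProbabilityMeasure ν] {s : ℝ} (hs : 0 < s) (hs1 : s ≤ 1)
    (h : klDiv μ ν ≤ ENNReal.ofReal (s ^ 2)) : SetwiseClose (2 * s) μ ν := by
  intro E hE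
  have h1 := measureReal_sub_le_of_klDiv_le hs hs1 h E
  have h2 := measureReal_sub_le_of_klDiv_le hs hs1 h Eᶜ
  rw [probReal_compl_eq_one_sub hE, probReal_compl_eq_one_sub hE] at h2
  exact abs_le.2 ⟨by linarith, h1⟩

theorem exists_setwiseClose_of_klDiv_lt {η : ℝ} (hη : 0 < η) :
    ∃ r : ℝ≥0∞, 0 < r ∧ ∀ (α : Type) [MeasurableSpace α] (μ ν : Measure α)
      [IsProbabilityMeasure μ] [IsProbabilityMeasure ν], klDiv μ ν < r → SetwiseClose η μ ν := by
  have hs : 0 < min (η / 2) 1 := by positivity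
  refine ⟨ENNReal.ofReal ((min (η / 2) 1) ^ 2), by positivity, fun α _ μ ν _ _ h E hE => ?_⟩
  refine (setwiseClose_of_klDiv_le hs (min_le_right _ _) h.le E hE).trans ?_
  linarith [min_le_left (η / 2) 1]

/-- A measure with density close to one is close in Kullback-Leibler divergence. -/
theorem klDiv_withDensity_le {α : Type*} [MeasurableSpace α] {μ : Measure α}
    [IsProbabilityMeasure μ] {f : α → ℝ≥0∞} (hf : Measurable f)
    [IsFiniteMeasure (μ.withDensity f)] {ρ : ℝ}
    (h : ∀ x, klFun (f x).toReal ≤ ρ) : klDiv (μ.withDensity f) μ ≤ ENNReal.ofReal ρ := by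
  rw [klDiv_eq_lintegral_klFun_of_ac (withDensity_absolutelyContinuous _ _)]
  calc ∫⁻ x, ENNReal.ofReal (klFun ((μ.withDensity f).rnDeriv μ x).toReal) ∂μ
      = ∫⁻ x, ENNReal.ofReal (klFun (f x).toReal) ∂μ := by
        refine lintegral_congr_ae ?_
        filter_upwards [Measure.rnDeriv_withDensity μ hf] with x hx
        rw [hx]
    _ ≤ ∫⁻ _, ENNReal.ofReal ρ ∂μ := lintegral_mono fun x => ENNReal.ofReal_le_ofReal (h x)
    _ = _ := by simp

/-- For the reversed order, μ has density 1/f with respect to the perturbed measure, so `klFun` must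
be small both at f and at 1/f. Both follow from continuity of `klFun` and its vanishing at 1. -/
theorem exists_klDiv_withDensity_lt {r : ℝ≥0∞} (hr : 0 < r) :
    ∃ ε : ℝ, 0 < ε ∧ ε < 1 ∧ ∀ (α : Type) [MeasurableSpace α] (μ : Measure α)
      [IsProbabilityMeasure μ] (f : α → ℝ) (_ : IsProbabilityMeasure
        (μ.withDensity fun x => ENNReal.ofReal (f x))), Measurable f → (∀ x, |f x - 1| ≤ ε) →
      klDiv (μ.withDensity fun x => ENNReal.ofReal (f x)) μ < r ∧
        klDiv μ (μ.withDensity fun x => ENNReal.ofReal (f x)) < r := by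
  obtain ⟨ρ, hρ, hρr⟩ : ∃ ρ : ℝ, 0 < ρ ∧ ENNReal.ofReal ρ < r := by
    obtain ⟨q, hq, hqr⟩ := ENNReal.lt_iff_exists_nnreal_btwn.1 hr
    exact ⟨q, by exact_mod_cast hq, by simpa using hqr⟩
  have h1 : ∀ᶠ x in 𝓝 (1 : ℝ), klFun x < ρ :=
    continuous_klFun.continuousAt.eventually_lt_const (by simpa [klFun_one] using hρ)
  have h2 : ∀ᶠ x in 𝓝 (1 : ℝ), klFun x⁻¹ < ρ := by
    have hc : ContinuousAt (fun x : ℝ => klFun x⁻¹) 1 :=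
      continuous_klFun.continuousAt.comp (continuousAt_inv₀ one_ne_zero)
    exact hc.eventually_lt_const (by simpa [klFun_one] using hρ)
  obtain ⟨ε₀, hε₀, hε⟩ := Metric.eventually_nhds_iff.1 (h1.and h2)
  -- The bound 1/2 keeps f positive, so that 1/f makes sense.
  refine ⟨min (ε₀ / 2) (1 / 2), by positivity,
    (min_le_right _ _).trans_lt (by norm_num), fun α _ μ _ f hP hf hfε => ?_⟩
  have hd : ∀ x, dist (f x) 1 < ε₀ := fun x => by
    rw [Real.dist_eq]
    exact ((hfε x).trans (min_le_left _ _)).trans_lt (by linarith)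
  have hpos : ∀ x, 0 < f x := fun x => by
    have := (abs_le.1 ((hfε x).trans (min_le_right _ _))).1
    linarith
  have hm : Measurable fun x => ENNReal.ofReal (f x) := hf.ennreal_ofReal
  have hinv := withDensity_inv_same (μ := μ) hm
    (Eventually.of_forall fun x => (ENNReal.ofReal_pos.2 (hpos x)).ne')
    (Eventually.of_forall fun x => ENNReal.ofReal_ne_top)
  constructor
  · refine (klDiv_withDensity_le hm fun x => ?_).trans_lt hρr
    rw [ENNReal.toReal_ofReal (hpos x).le]
    exact (hε (hd x)).1.le
  · have hfin : IsFiniteMeasure ((μ.withDensity fun x => ENNReal.ofReal (f x)).withDensity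
        fun x => (ENNReal.ofReal (f x))⁻¹) := by rw [hinv]; infer_instance
    have := klDiv_withDensity_le (μ := μ.withDensity fun x => ENNReal.ofReal (f x)) hm.inv
      (ρ := ρ) (fun x => by
        rw [Pi.inv_apply, ENNReal.toReal_inv, ENNReal.toReal_ofReal (hpos x).le]
        exact (hε (hd x)).2.le)
    change klDiv ((μ.withDensity fun x => ENNReal.ofReal (f x)).withDensity
        fun x => (ENNReal.ofReal (f x))⁻¹) _ ≤ _ at this
    rw [hinv] at this
    exact this.trans_lt hρr

/-! ### Reduction to the setwise closure -/

/-- The copulas that are setwise uniformly approximable by members of `S`. -/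
def setwiseClosure (S : Set PositiveCopula) : Set PositiveCopula :=
  {C | ∀ η : ℝ, 0 < η → ∃ D ∈ S, SetwiseClose η D.1.measure C.1.measure}

/-- If small divergence forces setwise closeness and no ball consists of setwise limits of `S`,
then `S` is nowhere dense. -/
theorem nowhereDenseWrt_of_setwiseClosure (δ : PositiveCopula → PositiveCopula → ℝ≥0∞)
    (S : Set PositiveCopula)
    (hδ : ∀ η : ℝ, 0 < η → ∃ r : ℝ≥0∞, 0 < r ∧ ∀ D C, δ D C < r →
      SetwiseClose η D.1.measure C.1.measure)
    (hball : ∀ (C : PositiveCopula) (r : ℝ≥0∞), 0 < r → ¬ divBall δ C r ⊆ setwiseClosure S) :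
    NowhereDenseWrt δ S := by
  refine ⟨?_, fun C r hr hsub => hball C r hr (hsub.trans ?_)⟩
  · let _ : TopologicalSpace PositiveCopula := divTopology δ
    change interior (closure S) = ∅
    -- The triangle inequality that the divergence lacks is supplied by setwise closeness.
    have hclosed : IsClosed (setwiseClosure S) := by
      refine ⟨fun C hC => ?_⟩
      simp only [setwiseClosure, mem_compl_iff, mem_ofPred_eq, not_forall] at hC
      obtain ⟨η, hη, hC⟩ := hC
      obtain ⟨r, hr, h⟩ := hδ (η / 2) (half_pos hη)
      refine ⟨r, hr, fun D hD hDS => hC ?_⟩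
      obtain ⟨T, hT, hTD⟩ := hDS (η / 2) (half_pos hη)
      exact ⟨T, hT, by simpa using hTD.trans (h D C hD)⟩
    have hS : S ⊆ setwiseClosure S := fun C hC η hη => ⟨C, hC, fun E _ => by simpa using hη.le⟩
    have hcl : closure S ⊆ setwiseClosure S := closure_minimal hS hclosed
    refine eq_empty_iff_forall_notMem.2 fun C hC => ?_
    obtain ⟨r, hr, h⟩ := (isOpen_interior : IsOpen (interior (closure S))) C hC
    exact hball C r hr (h.trans (interior_subset.trans hcl))
  · intro D hD η hη
    obtain ⟨r, hr, h⟩ := hδ η hη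
    obtain ⟨T, hT, hTS⟩ := hD r hr
    exact ⟨T, hTS, h T D hT⟩

/-! ### Lipschitz continuity of bivariate copulas -/

namespace BivariateCopula

instance (A : BivariateCopula) : IsProbabilityMeasure A.measure := by
  constructor
  have h : (A.measure.map Prod.fst) univ = 1 := by rw [A.map_fst]; exact measure_univ
  rwa [Measure.map_apply measurable_fst MeasurableSet.univ, preimage_univ] at h

theorem cdf_mono (A : BivariateCopula) {x x' y y' : I} (hx : x ≤ x') (hy : y ≤ y') :
    A.cdf x y ≤ A.cdf x' y' :=
  measureReal_mono (prod_mono (Iic_subset_Iic.2 hx) (Iic_subset_Iic.2 hy))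

/-- The difference of the two rectangles is covered by a vertical and a horizontal strip, whose
masses are prescribed by the margins. -/
theorem cdf_sub_le (A : BivariateCopula) {x x' y y' : I} (hx : x ≤ x') (hy : y ≤ y') :
    A.cdf x' y' - A.cdf x y ≤ (x' - x : ℝ) + (y' - y) := by
  have hsub : Iic x' ×ˢ Iic y' ⊆
      (Iic x ×ˢ Iic y) ∪ (Prod.fst ⁻¹' Ioc x x' ∪ Prod.snd ⁻¹' Ioc y y') := by
    rintro ⟨a, b⟩ ⟨ha, hb⟩
    simp only [mem_Iic, mem_union, mem_prod, mem_preimage, mem_Ioc] at *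
    rcases le_or_gt a x with h | h
    · rcases le_or_gt b y with h' | h'
      · exact Or.inl ⟨h, h'⟩
      · exact Or.inr (Or.inr ⟨h', hb⟩)
    · exact Or.inr (Or.inl ⟨h, ha⟩)
  have h1 : A.measure.real (Prod.fst ⁻¹' Ioc x x') = x' - x := by
    rw [← map_measureReal_apply measurable_fst measurableSet_Ioc, A.map_fst, measureReal_def,
      unitInterval.volume_Ioc, ENNReal.toReal_ofReal (sub_nonneg.2 hx)]
  have h2 : A.measure.real (Prod.snd ⁻¹' Ioc y y') = y' - y := by
    rw [← map_measureReal_apply measurable_snd measurableSet_Ioc, A.map_snd, measureReal_def,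
      unitInterval.volume_Ioc, ENNReal.toReal_ofReal (sub_nonneg.2 hy)]
  have h3 := (measureReal_mono hsub (μ := A.measure)).trans (measureReal_union_le _ _)
  have h4 := measureReal_union_le (μ := A.measure) (Prod.fst ⁻¹' Ioc x x') (Prod.snd ⁻¹' Ioc y y')
  unfold cdf
  linarith

/-- A bivariate copula is Lipschitz with constant one with respect to the `ℓ¹` distance. -/
theorem abs_cdf_sub_le (A : BivariateCopula) (x x' y y' : I) :
    |A.cdf x' y' - A.cdf x y| ≤ |(x' - x : ℝ)| + |(y' - y : ℝ)| := by
  have key : ∀ x x' y y' : I, A.cdf x' y' - A.cdf x y ≤ |(x' - x : ℝ)| + |(y' - y : ℝ)| := by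
    intro x x' y y'
    have h1 := A.cdf_mono (le_max_right x x') (le_max_right y y')
    have h2 := A.cdf_sub_le (le_max_left x x') (le_max_left y y')
    have h3 : ((max x x' : I) - x : ℝ) ≤ |(x' - x : ℝ)| := by
      rcases le_total x x' with h | h
      · rw [max_eq_right h]; exact le_abs_self _
      · rw [max_eq_left h]; simp
    have h4 : ((max y y' : I) - y : ℝ) ≤ |(y' - y : ℝ)| := by
      rcases le_total y y' with h | h
      · rw [max_eq_right h]; exact le_abs_self _
      · rw [max_eq_left h]; simp
    linarith
  refine abs_le.2 ⟨?_, key x x' y y'⟩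
  have := key x' x y' y
  rw [abs_sub_comm (x : ℝ), abs_sub_comm (y : ℝ)] at this
  linarith

theorem continuous_cdf (A : BivariateCopula) : Continuous fun p : I × I => A.cdf p.1 p.2 := by
  refine continuous_iff_continuousAt.2 fun p => ?_
  rw [ContinuousAt, tendsto_iff_dist_tendsto_zero]
  have h : Tendsto (fun q : I × I => |((q.1 : ℝ) - p.1)| + |((q.2 : ℝ) - p.2)|) (𝓝 p) (𝓝 0) := by
    have : Continuous fun q : I × I => |((q.1 : ℝ) - p.1)| + |((q.2 : ℝ) - p.2)| := by fun_prop
    simpa using this.tendsto p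
  exact squeeze_zero (fun _ => dist_nonneg) (fun q => A.abs_cdf_sub_le p.1 q.1 p.2 q.2) h

theorem cdf_nonneg (A : BivariateCopula) (x y : I) : 0 ≤ A.cdf x y := measureReal_nonneg

theorem cdf_le_one (A : BivariateCopula) (x y : I) : A.cdf x y ≤ 1 := measureReal_le_one

end BivariateCopula

/-! ### Markov kernels and approximate simplification -/

/-- The distribution function of a finite measure without atoms is continuous. -/
theorem continuous_measureReal_preimage_Iic {α : Type*} [MeasurableSpace α] (μ : Measure α)
    [IsFiniteMeasure μ] {f : α → I} (hf : Measurable f) (h : ∀ u, μ (f ⁻¹' {u}) = 0) :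
    Continuous fun u => μ.real (f ⁻¹' Iic u) := by
  have heq : (fun u => μ.real (f ⁻¹' Iic u)) =
      fun u => ∫ x, (if f x ≤ u then (1 : ℝ) else 0) ∂μ := by
    funext u
    rw [← integral_indicator_one (hf measurableSet_Iic)]
    rfl
  rw [heq]
  refine continuous_iff_continuousAt.2 fun u => ?_
  refine continuousAt_of_dominated (bound := fun _ => 1) ?_ ?_ (integrable_const _) ?_
  · refine Eventually.of_forall fun v => Measurable.aestronglyMeasurable ?_
    exact Measurable.ite (hf measurableSet_Iic) measurable_const measurable_const
  · refine Eventually.of_forall fun v => Eventually.of_forall fun x => ?_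
    split_ifs <;> simp
  · have : ∀ᵐ x ∂μ, f x ≠ u := by
      rw [ae_iff]; simpa [preimage] using h u
    filter_upwards [this] with x hx
    rcases lt_or_gt_of_ne hx with hlt | hlt
    · have : ∀ᶠ v in 𝓝 u, (1 : ℝ) = if f x ≤ v then 1 else 0 := by
        filter_upwards [lt_mem_nhds hlt] with v hv
        rw [if_pos hv.le]
      exact continuousAt_const.congr this
    · have : ∀ᶠ v in 𝓝 u, (0 : ℝ) = if f x ≤ v then 1 else 0 := by
        filter_upwards [gt_mem_nhds hlt] with v hv
        rw [if_neg (not_le.2 hv)]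
      exact continuousAt_const.congr this

namespace TrivariateCopula

theorem compProd_kernel (C : TrivariateCopula) :
    (volume : Measure I) ⊗ₘ C.kernel = C.measure.map Prod.swap := by
  have h := compProd_map_condDistrib (μ := C.measure) (X := Prod.snd) (Y := Prod.fst)
    (mβ := inferInstance) measurable_fst.aemeasurable
  have h3 : C.measure.map Prod.snd = volume := C.map_three
  rw [h3] at h
  exact h

theorem measurable_kernel_real (C : TrivariateCopula) {E : Set (I × I)} (hE : MeasurableSet E) :
    Measurable fun t => (C.kernel t).real E :=
  (C.kernel.measurable_coe hE).ennreal_toReal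

theorem integrable_kernel_real (C : TrivariateCopula) {E : Set (I × I)} (hE : MeasurableSet E) :
    Integrable fun t => (C.kernel t).real E :=
  Integrable.of_bound (C.measurable_kernel_real hE).aestronglyMeasurable 1
    (Eventually.of_forall fun t => by
      rw [Real.norm_eq_abs, abs_of_nonneg measureReal_nonneg]; exact measureReal_le_one)

theorem measureReal_prod (C : TrivariateCopula) {E : Set (I × I)} (hE : MeasurableSet E)
    {B : Set I} (hB : MeasurableSet B) :
    C.measure.real (E ×ˢ B) = ∫ t in B, (C.kernel t).real E := by
  have h : C.measure (E ×ˢ B) = ∫⁻ t in B, C.kernel t E := by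
    rw [← Measure.compProd_apply_prod hB hE, C.compProd_kernel,
      Measure.map_apply measurable_swap (hB.prod hE), preimage_swap_prod]
  rw [measureReal_def, h]
  exact (integral_toReal (C.kernel.measurable_coe hE).aemeasurable
    (Eventually.of_forall fun t => measure_lt_top _ _)).symm

theorem kernel_ae_absolutelyContinuous (C : TrivariateCopula) (hC : C.measure ≪ volume) :
    ∀ᵐ t : I, C.kernel t ≪ volume := by
  have h : (volume : Measure I) ⊗ₘ C.kernel ≪
      (volume : Measure I) ⊗ₘ Kernel.const I (volume : Measure (I × I)) := by
    rw [C.compProd_kernel, Measure.compProd_const]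
    have h1 := hC.map (measurable_swap (α := I × I) (β := I))
    have h2 : (volume : Measure ((I × I) × I)).map Prod.swap = volume := Measure.prod_swap
    rw [h2] at h1
    exact h1
  simpa using h.kernel_of_compProd

/-- The conditional distribution functions of an absolutely continuous copula are continuous. -/
theorem hasContinuousConditionals (C : TrivariateCopula) (hC : C.measure ≪ volume) :
    C.HasContinuousConditionals := by
  filter_upwards [C.kernel_ae_absolutelyContinuous hC] with t ht
  constructor
  · refine Continuous.subtype_mk ?_ _
    have := continuous_measureReal_preimage_Iic (C.kernel t) measurable_fst (fun u => ht (by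
      rw [← prod_univ, Measure.volume_eq_prod, Measure.prod_prod]; simp))
    simpa [← prod_univ] using this
  · refine Continuous.subtype_mk ?_ _
    have := continuous_measureReal_preimage_Iic (C.kernel t) measurable_snd (fun u => ht (by
      rw [← univ_prod, Measure.volume_eq_prod, Measure.prod_prod]; simp))
    simpa [← univ_prod] using this

theorem measurable_F₁ (C : TrivariateCopula) (u : I) : Measurable fun t => C.F₁ t u :=
  (C.measurable_kernel_real (measurableSet_Iic.prod MeasurableSet.univ)).subtype_mk

theorem measurable_F₂ (C : TrivariateCopula) (u : I) : Measurable fun t => C.F₂ t u :=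
  (C.measurable_kernel_real (MeasurableSet.univ.prod measurableSet_Iic)).subtype_mk

theorem integrable_cdf_F (C : TrivariateCopula) (A : BivariateCopula) (u₁ u₂ : I) :
    Integrable fun t => A.cdf (C.F₁ t u₁) (C.F₂ t u₂) :=
  Integrable.of_bound (A.continuous_cdf.measurable.comp
      ((C.measurable_F₁ u₁).prodMk (C.measurable_F₂ u₂))).aestronglyMeasurable 1
    (Eventually.of_forall fun t => by
      rw [Real.norm_eq_abs, abs_of_nonneg (A.cdf_nonneg _ _)]; exact A.cdf_le_one _ _)

/-- If two copulas are close on all measurable subsets of `E × B`, then their Markov kernels are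
close in mean on `E`. -/
theorem setIntegral_abs_kernel_sub_le (C D : TrivariateCopula) {η : ℝ} {E : Set (I × I)}
    (hE : MeasurableSet E) {B : Set I} (hB : MeasurableSet B)
    (h : ∀ B' ⊆ B, MeasurableSet B' →
      |C.measure.real (E ×ˢ B') - D.measure.real (E ×ˢ B')| ≤ η) :
    ∫ t in B, |(C.kernel t).real E - (D.kernel t).real E| ≤ 2 * η := by
  -- Splitting B by the sign of the difference removes the absolute value; each half contributes at
  -- most η.
  set P : Set I := {t | (D.kernel t).real E ≤ (C.kernel t).real E} with hP
  have hPm : MeasurableSet P :=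
    measurableSet_le (D.measurable_kernel_real hE) (C.measurable_kernel_real hE)
  have hc := C.integrable_kernel_real hE
  have hd := D.integrable_kernel_real hE
  have h1 : ∫ t in B ∩ P, |(C.kernel t).real E - (D.kernel t).real E| =
      C.measure.real (E ×ˢ (B ∩ P)) - D.measure.real (E ×ˢ (B ∩ P)) := by
    rw [C.measureReal_prod hE (hB.inter hPm), D.measureReal_prod hE (hB.inter hPm),
      ← integral_sub hc.integrableOn hd.integrableOn]
    refine setIntegral_congr_fun (hB.inter hPm) fun t ht => ?_
    exact abs_of_nonneg (sub_nonneg.2 ht.2)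
  have h2 : ∫ t in B ∩ Pᶜ, |(C.kernel t).real E - (D.kernel t).real E| =
      -(C.measure.real (E ×ˢ (B ∩ Pᶜ)) - D.measure.real (E ×ˢ (B ∩ Pᶜ))) := by
    rw [C.measureReal_prod hE (hB.inter hPm.compl), D.measureReal_prod hE (hB.inter hPm.compl),
      ← integral_sub hc.integrableOn hd.integrableOn, ← integral_neg]
    refine setIntegral_congr_fun (hB.inter hPm.compl) fun t ht => ?_
    exact abs_of_nonpos (sub_nonpos.2 (lt_of_not_ge fun h => ht.2 h).le)
  have h5 := integral_inter_add_sdiff (s := B) hPm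
    ((hc.sub hd).abs.integrableOn : IntegrableOn
      (fun t => |(C.kernel t).real E - (D.kernel t).real E|) B volume)
  simp only [sdiff_eq, Pi.sub_apply] at h5
  have h3 := (abs_le.1 (h (B ∩ P) inter_subset_left (hB.inter hPm))).2
  have h4 := (abs_le.1 (h (B ∩ Pᶜ) inter_subset_left (hB.inter hPm.compl))).1
  linarith

/-- A generalized simplified copula has, for almost every `t`, the conditional copula `A`. -/
theorem kernel_ae_eq_cdf (C : TrivariateCopula) (A : BivariateCopula)
    (hA : ∀ u₁ u₂ v : I, C.cdf u₁ u₂ v = ∫ t in Iic v, A.cdf (C.F₁ t u₁) (C.F₂ t u₂))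
    (u₁ u₂ : I) :
    ∀ᵐ t : I, (C.kernel t).real (Iic u₁ ×ˢ Iic u₂) = A.cdf (C.F₁ t u₁) (C.F₂ t u₂) := by
  have hR : MeasurableSet (Iic u₁ ×ˢ Iic u₂ : Set (I × I)) :=
    measurableSet_Iic.prod measurableSet_Iic
  have hk := C.integrable_kernel_real hR
  have hc := C.integrable_cdf_F A u₁ u₂
  have hk0 : 0 ≤ᵐ[volume] fun t => (C.kernel t).real (Iic u₁ ×ˢ Iic u₂) :=
    Eventually.of_forall fun t => measureReal_nonneg
  have hc0 : 0 ≤ᵐ[volume] fun t => A.cdf (C.F₁ t u₁) (C.F₂ t u₂) :=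
    Eventually.of_forall fun t => A.cdf_nonneg _ _
  have hfin := isFiniteMeasure_withDensity_ofReal hk.2
  have hfin' := isFiniteMeasure_withDensity_ofReal hc.2
  -- The defining identity says that the two densities have equal integrals over all initial
  -- intervals, which determine a finite measure.
  have hmeas : (volume : Measure I).withDensity
        (fun t => ENNReal.ofReal ((C.kernel t).real (Iic u₁ ×ˢ Iic u₂))) =
      volume.withDensity (fun t => ENNReal.ofReal (A.cdf (C.F₁ t u₁) (C.F₂ t u₂))) := by
    refine Measure.ext_of_Iic _ _ fun v => ?_
    rw [withDensity_apply _ measurableSet_Iic, withDensity_apply _ measurableSet_Iic,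
      ← ofReal_integral_eq_lintegral_ofReal hk.integrableOn (ae_restrict_of_ae hk0),
      ← ofReal_integral_eq_lintegral_ofReal hc.integrableOn (ae_restrict_of_ae hc0),
      ← C.measureReal_prod hR measurableSet_Iic, ← hA u₁ u₂ v]
    rfl
  have := (withDensity_eq_iff_of_sigmaFinite hk.1.aemeasurable.ennreal_ofReal
    hc.1.aemeasurable.ennreal_ofReal).1 hmeas
  filter_upwards [this] with t ht
  exact (ENNReal.ofReal_eq_ofReal_iff measureReal_nonneg (A.cdf_nonneg _ _)).1 ht

/-- A copula close to a generalized simplified one is approximately simplified. -/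
theorem integral_abs_kernel_sub_cdf_le (C S : TrivariateCopula) (A : BivariateCopula)
    (hA : ∀ u₁ u₂ v : I, S.cdf u₁ u₂ v = ∫ t in Iic v, A.cdf (S.F₁ t u₁) (S.F₂ t u₂))
    {η : ℝ} (h : SetwiseClose η S.measure C.measure) (u₁ u₂ : I) :
    ∫ t, |(C.kernel t).real (Iic u₁ ×ˢ Iic u₂) - A.cdf (C.F₁ t u₁) (C.F₂ t u₂)| ≤ 6 * η := by
  -- This is used for the rectangle and, through the Lipschitz bound on A, for the two conditional
  -- distribution functions: three terms of 2η.
  have hk : ∀ E, MeasurableSet E → ∫ t, |(S.kernel t).real E - (C.kernel t).real E| ≤ 2 * η := by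
    intro E hE
    have := S.setIntegral_abs_kernel_sub_le C hE MeasurableSet.univ
      fun B _ hB => h _ (hE.prod hB)
    simpa using this
  have hi : ∀ E, MeasurableSet E →
      Integrable fun t => |(S.kernel t).real E - (C.kernel t).real E| :=
    fun E hE => ((S.integrable_kernel_real hE).sub (C.integrable_kernel_real hE)).abs
  have hR : MeasurableSet (Iic u₁ ×ˢ Iic u₂ : Set (I × I)) :=
    measurableSet_Iic.prod measurableSet_Iic
  have hR₁ : MeasurableSet (Iic u₁ ×ˢ univ : Set (I × I)) := measurableSet_Iic.prod .univ
  have hR₂ : MeasurableSet (univ ×ˢ Iic u₂ : Set (I × I)) :=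
    MeasurableSet.univ.prod measurableSet_Iic
  calc ∫ t, |(C.kernel t).real (Iic u₁ ×ˢ Iic u₂) - A.cdf (C.F₁ t u₁) (C.F₂ t u₂)|
      ≤ ∫ t, (|(S.kernel t).real (Iic u₁ ×ˢ Iic u₂) - (C.kernel t).real (Iic u₁ ×ˢ Iic u₂)| +
          (|(S.kernel t).real (Iic u₁ ×ˢ univ) - (C.kernel t).real (Iic u₁ ×ˢ univ)| +
            |(S.kernel t).real (univ ×ˢ Iic u₂) - (C.kernel t).real (univ ×ˢ Iic u₂)|)) := by
        refine integral_mono_ae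
          ((C.integrable_kernel_real hR).sub (C.integrable_cdf_F A u₁ u₂)).abs
          ((hi _ hR).add ((hi _ hR₁).add (hi _ hR₂))) ?_
        filter_upwards [S.kernel_ae_eq_cdf A hA u₁ u₂] with t ht
        have h1 := A.abs_cdf_sub_le (C.F₁ t u₁) (S.F₁ t u₁) (C.F₂ t u₂) (S.F₂ t u₂)
        rw [← ht] at h1
        have h2 := abs_sub_le ((C.kernel t).real (Iic u₁ ×ˢ Iic u₂))
          ((S.kernel t).real (Iic u₁ ×ˢ Iic u₂)) (A.cdf (C.F₁ t u₁) (C.F₂ t u₂))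
        rw [abs_sub_comm ((C.kernel t).real (Iic u₁ ×ˢ Iic u₂)) ((S.kernel t).real _)] at h2
        exact h2.trans (add_le_add_right h1 _)
    _ ≤ 2 * η + (2 * η + 2 * η) := by
        refine (integral_add (hi _ hR) ((hi _ hR₁).add (hi _ hR₂))).trans_le ?_
        refine add_le_add (hk _ hR) ((integral_add (hi _ hR₁) (hi _ hR₂)).trans_le ?_)
        exact add_le_add (hk _ hR₁) (hk _ hR₂)
    _ = 6 * η := by ring

end TrivariateCopula

/-! ### Rigidity of setwise limits -/

/-- Functions whose integrals are geometrically small tend to zero almost everywhere. -/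
theorem ae_tendsto_zero_of_integral_le_geometric {α : Type*} [MeasurableSpace α] {μ : Measure α}
    {g : ℕ → α → ℝ} (hg : ∀ n, Integrable (g n) μ) (hg0 : ∀ n x, 0 ≤ g n x) {c : ℝ}
    (h : ∀ n, ∫ x, g n x ∂μ ≤ c * (1 / 2) ^ n) :
    ∀ᵐ x ∂μ, Tendsto (fun n => g n x) atTop (𝓝 0) := by
  -- The sum of the functions has finite integral, so it converges almost everywhere and its terms
  -- tend to zero.
  have hs : ∫⁻ x, ∑' n, ENNReal.ofReal (g n x) ∂μ ≠ ∞ := by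
    rw [lintegral_tsum fun n => (hg n).1.aemeasurable.ennreal_ofReal]
    have hsum : Summable fun n : ℕ => c * (1 / 2 : ℝ) ^ n :=
      (summable_geometric_of_lt_one (by norm_num) (by norm_num)).mul_left c
    refine ne_top_of_le_ne_top hsum.tsum_ofReal_ne_top (ENNReal.tsum_le_tsum fun n => ?_)
    rw [← ofReal_integral_eq_lintegral_ofReal (hg n) (Eventually.of_forall (hg0 n))]
    exact ENNReal.ofReal_le_ofReal (h n)
  have hlt := ae_lt_top' (AEMeasurable.tsum
    fun n => (hg n).1.aemeasurable.ennreal_ofReal) hs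
  filter_upwards [hlt] with x hx
  have := (ENNReal.tendsto_toReal_zero_iff fun n => ENNReal.ofReal_ne_top).2
    (ENNReal.tendsto_atTop_zero_of_tsum_ne_top hx.ne)
  simpa [ENNReal.toReal_ofReal (hg0 _ x)] using this

namespace TrivariateCopula

theorem kernel_ae_eq_restrict (C D : TrivariateCopula) {E : Set (I × I)} (hE : MeasurableSet E)
    {B : Set I} (hB : MeasurableSet B)
    (h : ∀ B' ⊆ B, MeasurableSet B' → C.measure.real (E ×ˢ B') = D.measure.real (E ×ˢ B')) :
    ∀ᵐ t ∂(volume.restrict B), (C.kernel t).real E = (D.kernel t).real E := by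
  have hi : Integrable (fun t => |(C.kernel t).real E - (D.kernel t).real E|) :=
    ((C.integrable_kernel_real hE).sub (D.integrable_kernel_real hE)).abs
  have h1 := C.setIntegral_abs_kernel_sub_le D (η := 0) hE hB
    fun B' hB' hm => by rw [h B' hB' hm]; simp
  have h2 : ∫ t in B, |(C.kernel t).real E - (D.kernel t).real E| = 0 :=
    le_antisymm (by simpa using h1) (integral_nonneg fun _ => abs_nonneg _)
  filter_upwards [(integral_eq_zero_iff_of_nonneg (fun _ => abs_nonneg _) hi.integrableOn).1 h2]
    with t ht
  exact sub_eq_zero.1 (abs_eq_zero.1 ht)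

/-- The conditional law of the first coordinate given the third depends only on the (1,3) margin. -/
theorem F₁_ae_eq (C D : TrivariateCopula)
    (h : C.measure.map (fun x => (x.1.1, x.2)) = D.measure.map (fun x => (x.1.1, x.2))) (u : I) :
    ∀ᵐ t : I, C.F₁ t u = D.F₁ t u := by
  have := C.kernel_ae_eq_restrict D (measurableSet_Iic (a := u) |>.prod .univ) .univ
    fun B _ hB => by
      have h1 := congrArg (fun μ => μ.real (Iic u ×ˢ B)) h
      beta_reduce at h1
      rw [map_measureReal_apply (by fun_prop) (measurableSet_Iic.prod hB),
        map_measureReal_apply (by fun_prop) (measurableSet_Iic.prod hB)] at h1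
      convert h1 using 2 <;> (ext x; simp)
  rw [Measure.restrict_univ] at this
  filter_upwards [this] with t ht
  exact Subtype.ext ht

theorem F₂_ae_eq (C D : TrivariateCopula)
    (h : C.measure.map (fun x => (x.1.2, x.2)) = D.measure.map (fun x => (x.1.2, x.2))) (u : I) :
    ∀ᵐ t : I, C.F₂ t u = D.F₂ t u := by
  have := C.kernel_ae_eq_restrict D (MeasurableSet.univ.prod (measurableSet_Iic (a := u))) .univ
    fun B _ hB => by
      have h1 := congrArg (fun μ => μ.real (Iic u ×ˢ B)) h
      beta_reduce at h1
      rw [map_measureReal_apply (by fun_prop) (measurableSet_Iic.prod hB),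
        map_measureReal_apply (by fun_prop) (measurableSet_Iic.prod hB)] at h1
      convert h1 using 2 <;> (ext x; simp)
  rw [Measure.restrict_univ] at this
  filter_upwards [this] with t ht
  exact Subtype.ext ht

theorem surjective_of_continuous_of_zero_of_one {f : I → I} (hf : Continuous f) (h0 : f 0 = 0)
    (h1 : f 1 = 1) : Function.Surjective f := fun y => by
  obtain ⟨x, -, hx⟩ := intermediate_value_Icc (zero_le_one : (0 : I) ≤ 1) hf.continuousOn
    (show y ∈ Icc (f 0) (f 1) by rw [h0, h1]; exact ⟨unitInterval.nonneg', unitInterval.le_one'⟩)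
  exact ⟨x, hx⟩

/-- Absolute continuity of the fibre makes {0} null, so the distribution function starts at 0; it
ends at 1, and continuity fills the gap. -/
theorem surjective_F₁ (C : TrivariateCopula) {t : I} (ht : C.kernel t ≪ volume)
    (hc : Continuous (C.F₁ t)) : Function.Surjective (C.F₁ t) := by
  refine surjective_of_continuous_of_zero_of_one hc (Subtype.ext ?_) (Subtype.ext ?_)
  · have : C.kernel t (Iic 0 ×ˢ univ) = 0 := ht (by
      rw [Measure.volume_eq_prod, Measure.prod_prod]; simp)
    simp [F₁, measureReal_def, this]
  · have : (Iic 1 : Set I) = univ := eq_univ_of_forall fun x => unitInterval.le_one'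
    simp [F₁, this]

theorem surjective_F₂ (C : TrivariateCopula) {t : I} (ht : C.kernel t ≪ volume)
    (hc : Continuous (C.F₂ t)) : Function.Surjective (C.F₂ t) := by
  refine surjective_of_continuous_of_zero_of_one hc (Subtype.ext ?_) (Subtype.ext ?_)
  · have : C.kernel t (univ ×ˢ Iic 0) = 0 := ht (by
      rw [Measure.volume_eq_prod, Measure.prod_prod]; simp)
    simp [F₂, measureReal_def, this]
  · have : (Iic 1 : Set I) = univ := eq_univ_of_forall fun x => unitInterval.le_one'
    simp [F₂, this]

end TrivariateCopula

/-- Convergence of differences of copulas on a dense set of points implies convergence. -/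
theorem BivariateCopula.tendsto_cdf_sub_of_denseRange {A A' : ℕ → BivariateCopula} {ι κ : Type*}
    {f : ι → I} {g : κ → I} (hf : DenseRange f) (hg : DenseRange g)
    (h : ∀ i j, Tendsto (fun n => |(A n).cdf (f i) (g j) - (A' n).cdf (f i) (g j)|) atTop (𝓝 0))
    (x y : I) : Tendsto (fun n => |(A n).cdf x y - (A' n).cdf x y|) atTop (𝓝 0) := by
  rw [Metric.tendsto_atTop]
  intro ε hε
  -- Moving to a grid point changes each of the two copulas by at most ε/8 + ε/8; the grid point
  -- itself contributes ε/2.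
  obtain ⟨i, hi⟩ := hf.exists_dist_lt x (ε := ε / 8) (by positivity)
  obtain ⟨j, hj⟩ := hg.exists_dist_lt y (ε := ε / 8) (by positivity)
  obtain ⟨N, hN⟩ := Metric.tendsto_atTop.1 (h i j) (ε / 2) (by positivity)
  refine ⟨N, fun n hn => ?_⟩
  have h1 := hN n hn
  rw [Subtype.dist_eq, Real.dist_eq] at hi hj
  rw [Real.dist_eq, sub_zero, abs_abs] at h1 ⊢
  have h2 := abs_le.1 ((A n).abs_cdf_sub_le (f i) x (g j) y)
  have h3 := abs_le.1 ((A' n).abs_cdf_sub_le (f i) x (g j) y)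
  have h4 := abs_lt.1 h1
  exact abs_lt.2 ⟨by linarith [h2.1, h3.2], by linarith [h2.2, h3.1]⟩

/-- Two setwise limits of simplified copulas with the same bivariate margins involving the third
coordinate coincide if their conditional laws coincide on a set of positive measure. -/
theorem measureReal_prod_eq_of_mem_setwiseClosure {C D : PositiveCopula}
    (hC : C ∈ setwiseClosure simplifiedCopulas) (hD : D ∈ setwiseClosure simplifiedCopulas)
    (h13 : C.1.measure.map (fun x => (x.1.1, x.2)) = D.1.measure.map (fun x => (x.1.1, x.2)))
    (h23 : C.1.measure.map (fun x => (x.1.2, x.2)) = D.1.measure.map (fun x => (x.1.2, x.2)))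
    {T : Set I} (hT : MeasurableSet T) (hT0 : volume T ≠ 0)
    (hCD : ∀ E B, MeasurableSet E → MeasurableSet B → B ⊆ T →
      C.1.measure.real (E ×ˢ B) = D.1.measure.real (E ×ˢ B))
    (u₁ u₂ : I) {B : Set I} (hB : MeasurableSet B) :
    C.1.measure.real ((Iic u₁ ×ˢ Iic u₂) ×ˢ B) = D.1.measure.real ((Iic u₁ ×ˢ Iic u₂) ×ˢ B) := by
  have hR : ∀ u₁ u₂ : I, MeasurableSet (Iic u₁ ×ˢ Iic u₂ : Set (I × I)) :=
    fun _ _ => measurableSet_Iic.prod measurableSet_Iic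
  have approx : ∀ X : PositiveCopula, X ∈ setwiseClosure simplifiedCopulas →
      ∀ n : ℕ, ∃ A : BivariateCopula, ∀ u₁ u₂ : I,
        ∫ t, |(X.1.kernel t).real (Iic u₁ ×ˢ Iic u₂) - A.cdf (X.1.F₁ t u₁) (X.1.F₂ t u₂)| ≤
          6 * (1 / 2) ^ n := by
    intro X hX n
    -- The geometric rate gives almost everywhere convergence without passing to a subsequence.
    obtain ⟨S, ⟨⟨A, hA⟩, -⟩, hS⟩ := hX ((1 / 2) ^ n) (by positivity)
    exact ⟨A, X.1.integral_abs_kernel_sub_cdf_le S.1 A hA hS⟩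
  choose A hA using approx C hC
  choose A' hA'D using approx D hD
  have hA' : ∀ n u₁ u₂, ∫ t, |(D.1.kernel t).real (Iic u₁ ×ˢ Iic u₂) -
      (A' n).cdf (C.1.F₁ t u₁) (C.1.F₂ t u₂)| ≤ 6 * (1 / 2) ^ n := by
    intro n u₁ u₂
    refine (integral_congr_ae ?_).trans_le (hA'D n u₁ u₂)
    filter_upwards [C.1.F₁_ae_eq D.1 h13 u₁, C.1.F₂_ae_eq D.1 h23 u₂] with t h1 h2
    simp only [h1, h2]
  have hiC : ∀ u₁ u₂ n, Integrable fun t => |(C.1.kernel t).real (Iic u₁ ×ˢ Iic u₂) -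
      (A n).cdf (C.1.F₁ t u₁) (C.1.F₂ t u₂)| := fun u₁ u₂ n =>
    ((C.1.integrable_kernel_real (hR _ _)).sub (C.1.integrable_cdf_F _ u₁ u₂)).abs
  have hiD : ∀ u₁ u₂ n, Integrable fun t => |(D.1.kernel t).real (Iic u₁ ×ˢ Iic u₂) -
      (A' n).cdf (C.1.F₁ t u₁) (C.1.F₂ t u₂)| := fun u₁ u₂ n =>
    ((D.1.integrable_kernel_real (hR _ _)).sub (C.1.integrable_cdf_F _ u₁ u₂)).abs
  let b : I → I → ℕ → I → ℝ := fun u₁ u₂ n t =>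
    |(A n).cdf (C.1.F₁ t u₁) (C.1.F₂ t u₂) - (A' n).cdf (C.1.F₁ t u₁) (C.1.F₂ t u₂)|
  have hb : ∀ u₁ u₂ n, Integrable (b u₁ u₂ n) := fun u₁ u₂ n =>
    ((C.1.integrable_cdf_F _ u₁ u₂).sub (C.1.integrable_cdf_F _ u₁ u₂)).abs
  have hbT : ∀ u₁ u₂ n, ∫ t in T, b u₁ u₂ n t ≤ 12 * (1 / 2) ^ n := by
    intro u₁ u₂ n
    have hle : ∫ t in T, b u₁ u₂ n t ≤
        ∫ t in T, (|(C.1.kernel t).real (Iic u₁ ×ˢ Iic u₂) -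
          (A n).cdf (C.1.F₁ t u₁) (C.1.F₂ t u₂)| + |(D.1.kernel t).real (Iic u₁ ×ˢ Iic u₂) -
          (A' n).cdf (C.1.F₁ t u₁) (C.1.F₂ t u₂)|) := by
      refine integral_mono_ae (hb u₁ u₂ n).integrableOn
        ((hiC u₁ u₂ n).add (hiD u₁ u₂ n)).integrableOn ?_
      -- On T both approximants are compared with one common conditional law.
      filter_upwards [C.1.kernel_ae_eq_restrict D.1 (hR u₁ u₂) hT
        fun B' hB' hm => hCD _ _ (hR u₁ u₂) hm hB'] with t ht
      rw [← ht, abs_sub_comm ((C.1.kernel t).real _) ((A n).cdf _ _)]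
      exact abs_sub_le _ _ _
    have h1 := setIntegral_le_integral (s := T) (hiC u₁ u₂ n)
      (Eventually.of_forall fun _ => abs_nonneg _)
    have h2 := setIntegral_le_integral (s := T) (hiD u₁ u₂ n)
      (Eventually.of_forall fun _ => abs_nonneg _)
    rw [integral_add (hiC u₁ u₂ n).integrableOn (hiD u₁ u₂ n).integrableOn] at hle
    linarith [hA n u₁ u₂, hA' n u₁ u₂]
  obtain ⟨q, hq⟩ := TopologicalSpace.exists_dense_seq I
  have hlim : ∀ᵐ t ∂(volume.restrict T), ∀ i j,
      Tendsto (fun n => b (q i) (q j) n t) atTop (𝓝 0) := by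
    rw [ae_all_iff]; intro i
    rw [ae_all_iff]; intro j
    exact ae_tendsto_zero_of_integral_le_geometric (fun n => (hb _ _ n).integrableOn)
      (fun _ _ => abs_nonneg _) (hbT (q i) (q j))
  have hne : NeBot (ae (volume.restrict T)) := by
    rw [ae_neBot]; simpa using hT0
  -- A single t₀ is enough: A_n and A'_n do not depend on t, so what is learned along the fibre over
  -- t₀ holds for every t.
  obtain ⟨t₀, h1, h2, h3⟩ := (hlim.and ((ae_restrict_of_ae
    (C.1.kernel_ae_absolutelyContinuous C.2.1)).and
      (ae_restrict_of_ae (C.1.hasContinuousConditionals C.2.1)))).exists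
  have hpt := BivariateCopula.tendsto_cdf_sub_of_denseRange
    ((C.1.surjective_F₁ h2 h3.1).denseRange.comp hq h3.1)
    ((C.1.surjective_F₂ h2 h3.2).denseRange.comp hq h3.2) h1
  have hint : Tendsto (fun n => ∫ t in B, b u₁ u₂ n t) atTop (𝓝 0) := by
    have := tendsto_integral_of_dominated_convergence (μ := volume.restrict B)
      (F := b u₁ u₂) (f := fun _ => 0) (fun _ => 1)
      (fun n => (hb u₁ u₂ n).integrableOn.1) (integrable_const _)
      (fun n => Eventually.of_forall fun t => by
        rw [Real.norm_eq_abs, abs_abs]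
        refine abs_sub_le_of_nonneg_of_le ?_ ?_ ?_ ?_
        exacts [BivariateCopula.cdf_nonneg _ _ _, BivariateCopula.cdf_le_one _ _ _,
          BivariateCopula.cdf_nonneg _ _ _, BivariateCopula.cdf_le_one _ _ _])
      (Eventually.of_forall fun t => hpt _ _)
    simpa using this
  -- The chain C, A_n, A'_n, D is now run over an arbitrary B, which need not meet T.
  have hbound : ∀ n : ℕ, |C.1.measure.real ((Iic u₁ ×ˢ Iic u₂) ×ˢ B) -
      D.1.measure.real ((Iic u₁ ×ˢ Iic u₂) ×ˢ B)| ≤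
        12 * (1 / 2) ^ n + ∫ t in B, b u₁ u₂ n t := by
    intro n
    rw [C.1.measureReal_prod (hR _ _) hB, D.1.measureReal_prod (hR _ _) hB,
      ← integral_sub (C.1.integrable_kernel_real (hR _ _)).integrableOn
        (D.1.integrable_kernel_real (hR _ _)).integrableOn]
    refine abs_integral_le_integral_abs.trans ?_
    have hle : ∫ t in B, |(C.1.kernel t).real (Iic u₁ ×ˢ Iic u₂) -
        (D.1.kernel t).real (Iic u₁ ×ˢ Iic u₂)| ≤
        ∫ t in B, ((|(C.1.kernel t).real (Iic u₁ ×ˢ Iic u₂) -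
          (A n).cdf (C.1.F₁ t u₁) (C.1.F₂ t u₂)| + |(D.1.kernel t).real (Iic u₁ ×ˢ Iic u₂) -
          (A' n).cdf (C.1.F₁ t u₁) (C.1.F₂ t u₂)|) + b u₁ u₂ n t) := by
      refine integral_mono (((C.1.integrable_kernel_real (hR _ _)).sub
        (D.1.integrable_kernel_real (hR _ _))).abs).integrableOn
        (((hiC u₁ u₂ n).add (hiD u₁ u₂ n)).add (hb u₁ u₂ n)).integrableOn fun t => ?_
      have e1 := abs_sub_le ((C.1.kernel t).real (Iic u₁ ×ˢ Iic u₂))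
        ((A n).cdf (C.1.F₁ t u₁) (C.1.F₂ t u₂)) ((D.1.kernel t).real (Iic u₁ ×ˢ Iic u₂))
      have e2 := abs_sub_le ((A n).cdf (C.1.F₁ t u₁) (C.1.F₂ t u₂))
        ((A' n).cdf (C.1.F₁ t u₁) (C.1.F₂ t u₂)) ((D.1.kernel t).real (Iic u₁ ×ˢ Iic u₂))
      rw [abs_sub_comm ((A' n).cdf _ _)] at e2
      simp only [b]
      linarith
    have h1 := setIntegral_le_integral (s := B) (hiC u₁ u₂ n)
      (Eventually.of_forall fun _ => abs_nonneg _)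
    have h2 := setIntegral_le_integral (s := B) (hiD u₁ u₂ n)
      (Eventually.of_forall fun _ => abs_nonneg _)
    refine hle.trans ((integral_add ((hiC u₁ u₂ n).add (hiD u₁ u₂ n)).integrableOn
      (hb u₁ u₂ n).integrableOn).trans_le (add_le_add ?_ le_rfl))
    refine (integral_add (hiC u₁ u₂ n).integrableOn (hiD u₁ u₂ n).integrableOn).trans_le ?_
    linarith [hA n u₁ u₂, hA' n u₁ u₂]
  have hzero : Tendsto (fun n : ℕ => 12 * (1 / 2 : ℝ) ^ n + ∫ t in B, b u₁ u₂ n t) atTop (𝓝 0) := by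
    have := ((tendsto_pow_atTop_nhds_zero_of_lt_one (r := (1 / 2 : ℝ)) (by norm_num)
      (by norm_num)).const_mul 12).add hint
    simpa using this
  have := ge_of_tendsto' hzero hbound
  exact sub_eq_zero.1 (abs_eq_zero.1 (le_antisymm this (abs_nonneg _)))

/-! ### Reflections and margin-preserving transfer of mass -/

/-- Pulling back a density along a measure-preserving map. -/
theorem map_withDensity_comp {α : Type*} [MeasurableSpace α] {μ : Measure α} {φ : α → α}
    (hφ : MeasurePreserving φ μ μ) {g : α → ℝ≥0∞} (hg : Measurable g) :
    (μ.withDensity (g ∘ φ)).map φ = μ.withDensity g := by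
  ext s hs
  rw [Measure.map_apply hφ.measurable hs, withDensity_apply _ (hφ.measurable hs),
    withDensity_apply _ hs, ← hφ.setLIntegral_comp_preimage hs hg]
  rfl

namespace unitInterval

/-- The midpoint of the unit interval. -/
noncomputable def half : I := ⟨1 / 2, by norm_num, by norm_num⟩

theorem symm_lt_half {x : I} : σ x < half ↔ half < x := by
  rw [← Subtype.coe_lt_coe, ← Subtype.coe_lt_coe, coe_symm_eq]
  simp only [half]
  constructor <;> intro h <;> linarith

theorem half_lt_symm {x : I} : half < σ x ↔ x < half := by
  rw [← symm_lt_half, symm_symm]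

theorem volume_Iio_half_ne_zero : volume (Iio half) ≠ 0 := by
  rw [volume_Iio]; simp [half]

theorem volume_Ici_half_ne_zero : volume (Ici half) ≠ 0 := by
  rw [volume_Ici]; simp [half]; norm_num

end unitInterval

open unitInterval (half)

/-- Reflection of the first coordinate. -/
def flipOne (x : (I × I) × I) : (I × I) × I := ((unitInterval.symm x.1.1, x.1.2), x.2)

/-- Reflection of the second coordinate. -/
def flipTwo (x : (I × I) × I) : (I × I) × I := ((x.1.1, unitInterval.symm x.1.2), x.2)

theorem measurePreserving_flipOne : MeasurePreserving flipOne volume volume :=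
  (unitInterval.measurePreserving_symm.prod (MeasurePreserving.id volume)).prod
    (MeasurePreserving.id volume)

theorem measurePreserving_flipTwo : MeasurePreserving flipTwo volume volume :=
  ((MeasurePreserving.id volume).prod unitInterval.measurePreserving_symm).prod
    (MeasurePreserving.id volume)

theorem flipOne_flipOne (x : (I × I) × I) : flipOne (flipOne x) = x := by simp [flipOne]

theorem flipTwo_flipTwo (x : (I × I) × I) : flipTwo (flipTwo x) = x := by simp [flipTwo]

theorem flipOne_flipTwo (x : (I × I) × I) : flipOne (flipTwo x) = flipTwo (flipOne x) := rfl

/-- The minimum of a function over the orbits of the two reflections. -/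
def flipMin (c : (I × I) × I → ℝ≥0∞) (x : (I × I) × I) : ℝ≥0∞ :=
  min (min (c x) (c (flipOne x))) (min (c (flipTwo x)) (c (flipTwo (flipOne x))))

theorem measurable_flipMin {c : (I × I) × I → ℝ≥0∞} (hc : Measurable c) :
    Measurable (flipMin c) := by
  have h1 := measurePreserving_flipOne.measurable
  have h2 := measurePreserving_flipTwo.measurable
  exact (hc.min (hc.comp h1)).min ((hc.comp h2).min (hc.comp (h2.comp h1)))

theorem flipMin_flipOne (c : (I × I) × I → ℝ≥0∞) (x : (I × I) × I) :
    flipMin c (flipOne x) = flipMin c x := by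
  simp only [flipMin, flipOne_flipOne, ← flipOne_flipTwo]
  rw [min_comm (c (flipOne x)), min_comm (c (flipOne (flipTwo x)))]

theorem flipMin_flipTwo (c : (I × I) × I → ℝ≥0∞) (x : (I × I) × I) :
    flipMin c (flipTwo x) = flipMin c x := by
  simp only [flipMin, flipTwo_flipTwo, flipOne_flipTwo]
  rw [min_comm]

theorem flipMin_le (c : (I × I) × I → ℝ≥0∞) (x : (I × I) × I) : flipMin c x ≤ c x :=
  (min_le_left _ _).trans (min_le_left _ _)

/-- The part of the cube on which mass is added. -/
def gainSet : Set ((I × I) × I) :=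
  {x | x.2 < half ∧ (x.1.1 < half ∧ x.1.2 < half ∨ half < x.1.1 ∧ half < x.1.2)}

/-- The part of the cube from which mass is removed. -/
def lossSet : Set ((I × I) × I) :=
  {x | x.2 < half ∧ (x.1.1 < half ∧ half < x.1.2 ∨ half < x.1.1 ∧ x.1.2 < half)}

theorem measurableSet_gainSet : MeasurableSet gainSet := by
  refine MeasurableSet.inter ?_ (MeasurableSet.union (MeasurableSet.inter ?_ ?_)
    (MeasurableSet.inter ?_ ?_)) <;> first
    | exact measurableSet_lt (by fun_prop) measurable_const
    | exact measurableSet_lt measurable_const (by fun_prop)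

theorem measurableSet_lossSet : MeasurableSet lossSet := by
  refine MeasurableSet.inter ?_ (MeasurableSet.union (MeasurableSet.inter ?_ ?_)
    (MeasurableSet.inter ?_ ?_)) <;> first
    | exact measurableSet_lt (by fun_prop) measurable_const
    | exact measurableSet_lt measurable_const (by fun_prop)

theorem disjoint_gainSet_lossSet : Disjoint gainSet lossSet := by
  refine Set.disjoint_left.2 ?_
  rintro x ⟨-, ⟨h1, h2⟩ | ⟨h1, h2⟩⟩ ⟨-, ⟨h3, h4⟩ | ⟨h3, h4⟩⟩
  exacts [h2.not_gt h4, h1.not_gt h3, h1.not_gt h3, h2.not_gt h4]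

theorem flipOne_mem_gainSet {x : (I × I) × I} : flipOne x ∈ gainSet ↔ x ∈ lossSet := by
  simp only [gainSet, lossSet, flipOne, mem_ofPred_eq, unitInterval.symm_lt_half,
    unitInterval.half_lt_symm]
  tauto

theorem flipTwo_mem_gainSet {x : (I × I) × I} : flipTwo x ∈ gainSet ↔ x ∈ lossSet := by
  simp only [gainSet, lossSet, flipTwo, mem_ofPred_eq, unitInterval.symm_lt_half,
    unitInterval.half_lt_symm]

/-- The reflection preserves volume, leaves m invariant and exchanges the two sets, so it carries
the removed mass onto the added mass. -/
theorem map_flipOne_withDensity {m : (I × I) × I → ℝ≥0∞} (hm : Measurable m)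
    (h : ∀ x, m (flipOne x) = m x) :
    ((volume : Measure ((I × I) × I)).withDensity (lossSet.indicator m)).map flipOne =
      volume.withDensity (gainSet.indicator m) := by
  rw [← map_withDensity_comp measurePreserving_flipOne (hm.indicator measurableSet_gainSet)]
  congr 2
  funext x
  by_cases hx : x ∈ lossSet
  · simp [hx, flipOne_mem_gainSet.2 hx, h]
  · simp [hx, mt flipOne_mem_gainSet.1 hx]

theorem map_flipTwo_withDensity {m : (I × I) × I → ℝ≥0∞} (hm : Measurable m)
    (h : ∀ x, m (flipTwo x) = m x) :
    ((volume : Measure ((I × I) × I)).withDensity (lossSet.indicator m)).map flipTwo =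
      volume.withDensity (gainSet.indicator m) := by
  rw [← map_withDensity_comp measurePreserving_flipTwo (hm.indicator measurableSet_gainSet)]
  congr 2
  funext x
  by_cases hx : x ∈ lossSet
  · simp [hx, flipTwo_mem_gainSet.2 hx, h]
  · simp [hx, mt flipTwo_mem_gainSet.1 hx]

/-- Reflecting the second coordinate is invisible to the (1,3) margin, and reflecting the first is
invisible to the (2,3) margin. -/
theorem map_coord_withDensity_gainSet_eq {m : (I × I) × I → ℝ≥0∞} (hm : Measurable m)
    (h1 : ∀ x, m (flipOne x) = m x) (h2 : ∀ x, m (flipTwo x) = m x) :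
    ((volume : Measure ((I × I) × I)).withDensity (gainSet.indicator m)).map
        (fun x => (x.1.1, x.2)) =
      (volume.withDensity (lossSet.indicator m)).map (fun x => (x.1.1, x.2)) ∧
    ((volume : Measure ((I × I) × I)).withDensity (gainSet.indicator m)).map
        (fun x => (x.1.2, x.2)) =
      (volume.withDensity (lossSet.indicator m)).map (fun x => (x.1.2, x.2)) := by
  constructor
  · rw [← map_flipTwo_withDensity hm h2,
      Measure.map_map (by fun_prop) measurePreserving_flipTwo.measurable]
    rfl
  · rw [← map_flipOne_withDensity hm h1,
      Measure.map_map (by fun_prop) measurePreserving_flipOne.measurable]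
    rfl

theorem volume_absolutelyContinuous_of_hasPositiveDensity {C : TrivariateCopula}
    (hC : C.HasPositiveDensity) : volume ≪ C.measure := by
  have h := withDensity_absolutelyContinuous' (μ := (volume : Measure ((I × I) × I)))
    (Measure.measurable_rnDeriv C.measure volume).aemeasurable
    (by filter_upwards [hC.2] with x hx using hx.ne')
  rwa [Measure.withDensity_rnDeriv_eq _ _ hC.1] at h

/-- A relative density supported by a copula's mass which is moved within the fibres of both
margins `(1, 3)` and `(2, 3)`. -/
theorem exists_flip_invariant_density (C : PositiveCopula) :
    ∃ q : (I × I) × I → ℝ, Measurable q ∧ (∀ x, 0 ≤ q x) ∧ (∀ x, q x ≤ 1) ∧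
      (∀ᵐ x ∂C.1.measure, 0 < q x) ∧
      ((C.1.measure.withDensity (gainSet.indicator fun x => ENNReal.ofReal (q x))).map
          (fun x => (x.1.1, x.2)) =
        (C.1.measure.withDensity (lossSet.indicator fun x => ENNReal.ofReal (q x))).map
          (fun x => (x.1.1, x.2))) ∧
      ((C.1.measure.withDensity (gainSet.indicator fun x => ENNReal.ofReal (q x))).map
          (fun x => (x.1.2, x.2)) =
        (C.1.measure.withDensity (lossSet.indicator fun x => ENNReal.ofReal (q x))).map
          (fun x => (x.1.2, x.2))) := by
  set c := C.1.measure.rnDeriv volume with hcdef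
  have hc : Measurable c := Measure.measurable_rnDeriv _ _
  have hm := measurable_flipMin hc
  have hle : ∀ x, flipMin c x / c x ≤ 1 := fun x =>
    (ENNReal.div_le_div_right (flipMin_le c x) _).trans ENNReal.div_self_le_one
  have hofReal : ∀ x, ENNReal.ofReal (flipMin c x / c x).toReal = flipMin c x / c x := fun x =>
    ENNReal.ofReal_toReal (ne_top_of_le_ne_top ENNReal.one_ne_top (hle x))
  have hqm : Measurable fun x => flipMin c x / c x := hm.div hc
  have hpos : ∀ᵐ x, 0 < c x := C.2.2
  have hfin : ∀ᵐ x, c x < ∞ := Measure.rnDeriv_lt_top _ _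
  have hpos1 := measurePreserving_flipOne.quasiMeasurePreserving.ae hpos
  have hpos2 := measurePreserving_flipTwo.quasiMeasurePreserving.ae hpos
  have hpos3 := measurePreserving_flipOne.quasiMeasurePreserving.ae hpos2
  -- With q = `flipMin c / c`, the weight q relative to the copula is the reflection-invariant
  -- weight `flipMin c` relative to volume. Taking the minimum makes q at most 1.
  have hdens : ∀ P : Set ((I × I) × I), MeasurableSet P →
      C.1.measure.withDensity (P.indicator fun x => ENNReal.ofReal (flipMin c x / c x).toReal) =
        volume.withDensity (P.indicator (flipMin c)) := by
    intro P hP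
    simp only [hofReal]
    conv_lhs => rw [← Measure.withDensity_rnDeriv_eq _ _ C.2.1, ← hcdef]
    rw [← withDensity_mul _ hc (hqm.indicator hP)]
    refine withDensity_congr_ae ?_
    filter_upwards [hpos, hfin] with x h1 h2
    by_cases hx : x ∈ P
    · simp only [Pi.mul_apply, indicator_of_mem hx]
      exact ENNReal.mul_div_cancel h1.ne' h2.ne
    · simp [hx]
  obtain ⟨h13, h23⟩ := map_coord_withDensity_gainSet_eq hm (flipMin_flipOne c) (flipMin_flipTwo c)
  refine ⟨fun x => (flipMin c x / c x).toReal, hqm.ennreal_toReal,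
    fun x => ENNReal.toReal_nonneg, fun x => ENNReal.toReal_le_of_le_ofReal zero_le_one
      (by simpa using hle x), C.2.1.ae_le ?_, ?_, ?_⟩
  · filter_upwards [hpos, hfin, hpos1, hpos2, hpos3] with x h0 h h1 h2 h3
    refine ENNReal.toReal_pos (ENNReal.div_pos ?_ h.ne).ne'
      (ne_top_of_le_ne_top ENNReal.one_ne_top (hle x))
    exact (lt_min (lt_min h0 h1) (lt_min h2 h3)).ne'
  · rw [hdens _ measurableSet_gainSet, hdens _ measurableSet_lossSet, h13]
  · rw [hdens _ measurableSet_gainSet, hdens _ measurableSet_lossSet, h23]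

/-! ### The perturbed copula -/

/-- The density of the perturbed copula with respect to the original one. -/
noncomputable def perturbation (ε : ℝ) (q : (I × I) × I → ℝ) (x : (I × I) × I) : ℝ :=
  1 + gainSet.indicator (fun x => ε * q x) x - lossSet.indicator (fun x => ε * q x) x

theorem measurable_perturbation {ε : ℝ} {q : (I × I) × I → ℝ} (hq : Measurable q) :
    Measurable (perturbation ε q) :=
  (measurable_const.add ((hq.const_mul ε).indicator measurableSet_gainSet)).sub
    ((hq.const_mul ε).indicator measurableSet_lossSet)

theorem abs_perturbation_sub_one_le {ε : ℝ} (hε : 0 ≤ ε) {q : (I × I) × I → ℝ}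
    (hq0 : ∀ x, 0 ≤ q x) (hq1 : ∀ x, q x ≤ 1) (x : (I × I) × I) :
    |perturbation ε q x - 1| ≤ ε := by
  have h0 : 0 ≤ ε * q x := mul_nonneg hε (hq0 x)
  have h1 : ε * q x ≤ ε := mul_le_of_le_one_right hε (hq1 x)
  unfold perturbation
  simp only [indicator]
  split_ifs <;> rw [abs_le] <;> constructor <;> linarith

/-- The removed mass is put on the left to avoid subtracting measures. The bounds ε ≤ 1 and q ≤ 1
keep 1 - εq nonnegative, so `ENNReal.ofReal` does not truncate. -/
theorem withDensity_perturbation_add {μ : Measure ((I × I) × I)} {ε : ℝ} (hε : 0 ≤ ε)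
    (hε1 : ε ≤ 1) {q : (I × I) × I → ℝ} (hq : Measurable q)
    (hq0 : ∀ x, 0 ≤ q x) (hq1 : ∀ x, q x ≤ 1) :
    μ.withDensity (fun x => ENNReal.ofReal (perturbation ε q x)) + ENNReal.ofReal ε •
        μ.withDensity (lossSet.indicator fun x => ENNReal.ofReal (q x)) =
      μ + ENNReal.ofReal ε •
        μ.withDensity (gainSet.indicator fun x => ENNReal.ofReal (q x)) := by
  have hqm := hq.ennreal_ofReal
  rw [← withDensity_smul _ (hqm.indicator measurableSet_lossSet),
    ← withDensity_smul _ (hqm.indicator measurableSet_gainSet),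
    ← withDensity_add_left (measurable_perturbation hq).ennreal_ofReal]
  nth_rw 2 [← withDensity_one (μ := μ)]
  rw [← withDensity_add_left measurable_one]
  congr 1
  funext x
  have h0 : 0 ≤ ε * q x := mul_nonneg hε (hq0 x)
  have h1 : ε * q x ≤ 1 := mul_le_one₀ hε1 (hq0 x) (hq1 x)
  have hmul : ENNReal.ofReal ε * ENNReal.ofReal (q x) = ENNReal.ofReal (ε * q x) :=
    (ENNReal.ofReal_mul hε).symm
  simp only [Pi.add_apply, Pi.smul_apply, Pi.one_apply, smul_eq_mul, perturbation]
  by_cases hg : x ∈ gainSet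
  · have hl : x ∉ lossSet := Set.disjoint_left.1 disjoint_gainSet_lossSet hg
    simp only [indicator_of_mem hg, indicator_of_notMem hl, hmul]
    rw [mul_zero, add_zero, sub_zero, ENNReal.ofReal_add zero_le_one h0, ENNReal.ofReal_one]
  · by_cases hl : x ∈ lossSet
    · simp only [indicator_of_mem hl, indicator_of_notMem hg, hmul]
      rw [← ENNReal.ofReal_add (by linarith) h0]
      simp
    · simp [hg, hl]

theorem map_eq_of_add_smul_eq {α β : Type*} [MeasurableSpace α] [MeasurableSpace β]
    {μ ν ρ τ : Measure α} [IsFiniteMeasure ρ] {k : ℝ≥0∞} (hk : k ≠ ∞)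
    (h : μ + k • ρ = ν + k • τ) {f : α → β} (hf : Measurable f) (hρ : τ.map f = ρ.map f) :
    μ.map f = ν.map f := by
  ext s hs
  have h1 := congrArg (fun κ => (κ.map f) s) h
  beta_reduce at h1
  rw [Measure.map_add _ _ hf, Measure.map_add _ _ hf, Measure.map_smul, Measure.map_smul, hρ,
    Measure.add_apply, Measure.add_apply, Measure.smul_apply] at h1
  exact (ENNReal.add_left_inj (ENNReal.mul_ne_top hk
    (by rw [Measure.map_apply hf hs]; exact measure_ne_top _ _))).1 h1

theorem volume_lower_octant_ne_zero :
    (volume : Measure ((I × I) × I)) ((Iio half ×ˢ Iio half) ×ˢ Iio half) ≠ 0 := by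
  rw [Measure.volume_eq_prod, Measure.prod_prod, Measure.volume_eq_prod, Measure.prod_prod]
  have h := unitInterval.volume_Iio_half_ne_zero
  exact mul_ne_zero (mul_ne_zero h h) h

/-- Arbitrarily close to every copula with positive density there is another one with the same
bivariate margins involving the third coordinate and the same conditional laws given
`t ≥ 1 / 2`, but with different conditional laws given `t < 1 / 2`. -/
theorem exists_perturbed_copula (C : PositiveCopula) {r : ℝ≥0∞} (hr : 0 < r) :
    ∃ D : PositiveCopula, KL D C < r ∧ KL C D < r ∧
      C.1.measure.map (fun x => (x.1.1, x.2)) = D.1.measure.map (fun x => (x.1.1, x.2)) ∧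
      C.1.measure.map (fun x => (x.1.2, x.2)) = D.1.measure.map (fun x => (x.1.2, x.2)) ∧
      (∀ E B, MeasurableSet E → MeasurableSet B → B ⊆ Ici half →
        C.1.measure.real (E ×ˢ B) = D.1.measure.real (E ×ˢ B)) ∧
      C.1.measure.real ((Iic half ×ˢ Iic half) ×ˢ Iio half) ≠
        D.1.measure.real ((Iic half ×ˢ Iic half) ×ˢ Iio half) := by
  obtain ⟨ε, hε, hε1, hkl⟩ := exists_klDiv_withDensity_lt hr
  obtain ⟨q, hq, hq0, hq1, hqpos, h13, h23⟩ := exists_flip_invariant_density C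
  set μ := C.1.measure with hμ
  set G := μ.withDensity (gainSet.indicator fun x => ENNReal.ofReal (q x)) with hG
  set L := μ.withDensity (lossSet.indicator fun x => ENNReal.ofReal (q x)) with hL
  set f : (I × I) × I → ℝ≥0∞ := fun x => ENNReal.ofReal (perturbation ε q x) with hf
  set ν := μ.withDensity f with hν
  have hfm : Measurable f := (measurable_perturbation hq).ennreal_ofReal
  have hfin : ∀ P : Set ((I × I) × I),
      IsFiniteMeasure (μ.withDensity (P.indicator fun x => ENNReal.ofReal (q x))) := fun P => by
    refine isFiniteMeasure_withDensity (ne_top_of_le_ne_top (b := ∫⁻ _, 1 ∂μ) (by simp) ?_)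
    refine lintegral_mono fun x => indicator_le_self _ _ x |>.trans ?_
    simpa using hq1 x
  have hLfin : IsFiniteMeasure L := hfin _
  have hGfin : IsFiniteMeasure G := hfin _
  have hadd : ν + ENNReal.ofReal ε • L = μ + ENNReal.ofReal ε • G :=
    withDensity_perturbation_add hε.le hε1.le hq hq0 hq1
  have e13 : ν.map (fun x => (x.1.1, x.2)) = μ.map (fun x => (x.1.1, x.2)) :=
    map_eq_of_add_smul_eq ENNReal.ofReal_ne_top hadd (by fun_prop) h13
  have e23 : ν.map (fun x => (x.1.2, x.2)) = μ.map (fun x => (x.1.2, x.2)) :=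
    map_eq_of_add_smul_eq ENNReal.ofReal_ne_top hadd (by fun_prop) h23
  let D : TrivariateCopula :=
    { measure := ν
      map_one := by
        have := congrArg (Measure.map Prod.fst) e13
        rw [Measure.map_map (by fun_prop) (by fun_prop),
          Measure.map_map (by fun_prop) (by fun_prop)] at this
        exact this.trans C.1.map_one
      map_two := by
        have := congrArg (Measure.map Prod.fst) e23
        rw [Measure.map_map (by fun_prop) (by fun_prop),
          Measure.map_map (by fun_prop) (by fun_prop)] at this
        exact this.trans C.1.map_two
      map_three := by
        have := congrArg (Measure.map Prod.snd) e13
        rw [Measure.map_map (by fun_prop) (by fun_prop),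
          Measure.map_map (by fun_prop) (by fun_prop)] at this
        exact this.trans C.1.map_three }
  have habs := abs_perturbation_sub_one_le hε.le hq0 hq1
  have hD : D.HasPositiveDensity := by
    refine ⟨(withDensity_absolutelyContinuous _ _).trans C.2.1, ?_⟩
    filter_upwards [Measure.rnDeriv_withDensity_left_of_absolutelyContinuous C.2.1
      hfm.aemeasurable, C.2.2] with x h1 h2
    change 0 < ν.rnDeriv volume x
    rw [h1]
    refine ENNReal.mul_pos (ENNReal.ofReal_pos.2 ?_).ne' h2.ne'
    linarith [(abs_le.1 (habs x)).1]
  have hprob : ∀ X : TrivariateCopula, IsProbabilityMeasure X.measure := fun _ => inferInstance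
  have hνp : IsProbabilityMeasure ν := hprob D
  obtain ⟨k1, k2⟩ := hkl _ μ (perturbation ε q) hνp (measurable_perturbation hq) habs
  have hzero : ∀ (P s : Set ((I × I) × I)), MeasurableSet s → Disjoint P s →
      μ.withDensity (P.indicator fun x => ENNReal.ofReal (q x)) s = 0 := by
    intro P s hs hd
    rw [withDensity_apply _ hs]
    refine (setLIntegral_congr_fun hs fun x hx => ?_).trans lintegral_zero
    exact indicator_of_notMem (Set.disjoint_right.1 hd hx) _
  have hat : ∀ s, ν s + ENNReal.ofReal ε * L s = μ s + ENNReal.ofReal ε * G s := fun s => by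
    simpa using congrArg (fun κ => κ s) hadd
  refine ⟨⟨D, hD⟩, k1, k2, e13.symm, e23.symm, fun E B hE hB hBs => ?_, fun heq => ?_⟩
  · have h1 : G (E ×ˢ B) = 0 := hzero _ _ (hE.prod hB)
      (Set.disjoint_left.2 fun x hx hx' => (hBs hx'.2 : half ≤ x.2).not_gt hx.1)
    have h2 : L (E ×ˢ B) = 0 := hzero _ _ (hE.prod hB)
      (Set.disjoint_left.2 fun x hx hx' => (hBs hx'.2 : half ≤ x.2).not_gt hx.1)
    have h3 := hat (E ×ˢ B)
    rw [h1, h2, mul_zero, add_zero, add_zero] at h3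
    exact congrArg ENNReal.toReal h3.symm
  · have hs : MeasurableSet ((Iic half ×ˢ Iic half) ×ˢ Iio half : Set ((I × I) × I)) :=
      (measurableSet_Iic.prod measurableSet_Iic).prod measurableSet_Iio
    -- Every point of `lossSet` has a first or second coordinate above 1/2, so the test box only
    -- gains mass.
    have h2 : L ((Iic half ×ˢ Iic half) ×ˢ Iio half) = 0 := by
      refine hzero _ _ hs (Set.disjoint_left.2 ?_)
      rintro x ⟨-, ⟨-, h⟩ | ⟨h, -⟩⟩ ⟨⟨h1, h2⟩, -⟩
      exacts [h.not_ge h2, h.not_ge h1]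
    have h3 := hat ((Iic half ×ˢ Iic half) ×ˢ Iio half)
    have h4 : μ ((Iic half ×ˢ Iic half) ×ˢ Iio half) = ν ((Iic half ×ˢ Iic half) ×ˢ Iio half) :=
      (measureReal_eq_measureReal_iff).1 heq
    rw [h2, mul_zero, add_zero, ← h4] at h3
    have h5 : G ((Iic half ×ˢ Iic half) ×ˢ Iio half) = 0 := by
      have h6 : μ ((Iic half ×ˢ Iic half) ×ˢ Iio half) + 0 = μ ((Iic half ×ˢ Iic half) ×ˢ Iio half)
        + ENNReal.ofReal ε * G ((Iic half ×ˢ Iic half) ×ˢ Iio half) := by rw [add_zero]; exact h3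
      have h7 := (ENNReal.add_right_inj (measure_ne_top _ _)).1 h6
      exact (mul_eq_zero.1 h7.symm).resolve_left (ENNReal.ofReal_pos.2 hε).ne'
    -- No gain would mean that q vanishes almost everywhere on the open lower octant, but q > 0
    -- almost everywhere and the octant has positive mass.
    rw [hG, withDensity_apply_eq_zero (hq.ennreal_ofReal.indicator measurableSet_gainSet)] at h5
    refine volume_lower_octant_ne_zero (volume_absolutelyContinuous_of_hasPositiveDensity C.2 ?_)
    refine measure_mono_null_ae ?_ h5
    filter_upwards [hqpos] with x hx hxs
    obtain ⟨⟨h6, h7⟩, h8⟩ := hxs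
    refine ⟨?_, ⟨⟨mem_Iic.2 (mem_Iio.1 h6).le, mem_Iic.2 (mem_Iio.1 h7).le⟩, h8⟩⟩
    have hg : x ∈ gainSet := ⟨h8, Or.inl ⟨h6, h7⟩⟩
    simp only [mem_ofPred_eq, indicator_of_mem hg]
    exact (ENNReal.ofReal_pos.2 hx).ne'

/-! ### Conclusion -/

/-- No ball around a copula with positive density consists of setwise limits of simplified
copulas. -/
theorem not_divBall_subset_setwiseClosure {δ : PositiveCopula → PositiveCopula → ℝ≥0∞}
    (hδ : ∀ D C, δ D C = KL D C ∨ δ D C = KL C D) (C : PositiveCopula) {r : ℝ≥0∞} (hr : 0 < r) :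
    ¬ divBall δ C r ⊆ setwiseClosure simplifiedCopulas := by
  intro hsub
  have hself : δ C C = 0 := by
    rcases hδ C C with h | h <;> exact h.trans (klDiv_self _)
  have hC : C ∈ setwiseClosure simplifiedCopulas :=
    hsub (show δ C C < r by rw [hself]; exact hr)
  obtain ⟨D, k1, k2, h13, h23, heq, hne⟩ := exists_perturbed_copula C hr
  have hD : D ∈ setwiseClosure simplifiedCopulas := hsub <| show δ D C < r by
    rcases hδ D C with h | h <;> rw [h] <;> assumption
  -- The laws agree on T = [1/2, 1], so rigidity forces agreement over [0, 1/2), where the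
  -- perturbation was made.
  exact hne (measureReal_prod_eq_of_mem_setwiseClosure hC hD h13 h23 measurableSet_Ici
    unitInterval.volume_Ici_half_ne_zero heq half half measurableSet_Iio)

/-- The simplified copulas with positive density are nowhere dense with respect to the
Kullback-Leibler divergence among all absolutely continuous three-dimensional copulas with
positive density, for each of the two orders of the arguments of the divergence. -/
theorem theorem3p7 :
    NowhereDenseWrt (fun D C : PositiveCopula => KL D C) simplifiedCopulas ∧
      NowhereDenseWrt (fun D C : PositiveCopula => KL C D) simplifiedCopulas := by
  constructor
  · refine nowhereDenseWrt_of_setwiseClosure _ _ (fun η hη => ?_) fun C r hr =>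
      not_divBall_subset_setwiseClosure (fun _ _ => Or.inl rfl) C hr
    obtain ⟨r, hr, h⟩ := exists_setwiseClose_of_klDiv_lt hη
    exact ⟨r, hr, fun D C hDC => h _ _ _ hDC⟩
  · refine nowhereDenseWrt_of_setwiseClosure _ _ (fun η hη => ?_) fun C r hr =>
      not_divBall_subset_setwiseClosure (fun _ _ => Or.inr rfl) C hr
    obtain ⟨r, hr, h⟩ := exists_setwiseClose_of_klDiv_lt hη
    exact ⟨r, hr, fun D C hDC => (h _ _ _ hDC).symm⟩
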